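/- **Setting.** Let $\Gamma=(G,E)$ be a connected, locally finite graph without loops or multiple edges, with $G$ countably infinite, carrying symmetric edge weights $\pi_{xy}=\pi_{yx}\ge 0$ with $\pi_{xy}>0$ if and only if $\{x,y\}\in E$. Let $(\theta_x)_{x\in G}$ be positive vertex weights, and let $p_t(x,y)=\theta_y^{-1}\,\mathbb P^x(X_t=y)$ be the heat kernel of the (minimal, possibly explosive) continuous-time simple random walk $(X_t)_{t\ge0}$ with generator $$(\mathcal L_\theta f)(x)=\frac1{\theta_x}\sum_{y\sim x}\pi_{xy}\,(f(y)-f(x)).$$ Equivalently, $p_t(x,y)$ is the increasing limit, along finite sets $U\uparrow G$, of the heat kernels $p^{(U)}_t(x,y)=\theta_y^{-1}\big(e^{t\mathcal L_U}\big)_{xy}$ of the walk killed on leaving $U$, where $\mathcal L_U$ is $\mathcal L_\theta$ acting on functions supported in $U$ and restricted to $U$. Let $d_\theta$ be any metric on $G$ such that $$\frac1{\theta_x}\sum_{y\sim x}\pi_{xy}\,d_\theta(x,y)^2\le 1\ \text{ for all } x\in G,\qquad d_\theta(x,y)\le 1\ \text{ whenever } x\sim y .$$ For $A\ge1$ and $\gamma>1$,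 a nondecreasing function $g:(0,\infty)\to(0,\infty)$ is called $(A,\gamma)$-regular if $$\frac{g(\gamma t_1)}{g(t_1)}\le A\,\frac{g(\gamma t_2)}{g(t_2)}\qquad\text{for all } 0<t_1<t_2.$$ **Theorem 1.1.** For every $\gamma>1$ there exist constants $C_2=C_2(\gamma)>0$ and $\alpha=\alpha(\gamma)>0$, and for all $A\ge1$ and $C_\theta>0$ there exists a constant $C_1=C_1(A,\gamma,C_\theta)>0$, such that the following holds for every $(\Gamma,\pi)$, $(\theta_x)_{x\in G}$ and $d_\theta$ as above. Suppose that $\theta_x\ge C_\theta$ for all $x\in G$, that $f_1,f_2$ are $(A,\gamma)$-regular functions with $$\sup_{0<t<\infty}\frac{f_i(t)}{e^{\sqrt t}}\le A\qquad(i=1,2),$$ and that $x_1,x_2\in G$ are vertices with $$p_t(x_i,x_i)\le\frac1{f_i(t)}\qquad\text{for all } t>0,\ i=1,2 .$$ Then for all $t\ge 1\vee d_\theta(x_1,x_2)$, $$p_t(x_1,x_2)\le\frac{C_1}{\big(f_1(\alpha t)f_2(\alpha t)\big)^{1/2}}\exp\left(-C_2\,\frac{d_\theta(x_1,x_2)^2}{t}\right).$$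 No stochastic completeness is assumed. -/

import Mathlib

/-- A weighted graph `(Γ, π)` on the vertex set `V`: a connected, locally finite simple graph with
symmetric nonnegative edge weights `π x y` that are positive exactly on the edges. -/
structure WeightedGraph (V : Type*) where
  graph : SimpleGraph V
  connected : graph.Connected
  locallyFinite : ∀ x, (graph.neighborSet x).Finite
  weight : V → V → ℝ
  weight_symm : ∀ x y, weight x y = weight y x
  weight_nonneg : ∀ x y, 0 ≤ weight x y
  weight_pos_iff : ∀ x y, 0 < weight x y ↔ graph.Adj x y

namespace WeightedGraph

variable {V : Type*}

/-- The finite set of neighbours of `x`. -/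
noncomputable def nbrs (Γ : WeightedGraph V) (x : V) : Finset V := (Γ.locallyFinite x).toFinset

/-- The generator `(𝓛_θ f)(x) = θ_x⁻¹ ∑_{y ∼ x} π_{xy} (f y - f x)` of the continuous-time simple
random walk with vertex weights `θ`. -/
noncomputable def generator (Γ : WeightedGraph V) (θ : V → ℝ) (f : V → ℝ) (x : V) : ℝ :=
  (1 / θ x) * ∑ y ∈ Γ.nbrs x, Γ.weight x y * (f y - f x)

/-- The generator of the walk killed on leaving the finite set `U`, as a matrix indexed by `U`: it
is `𝓛_θ` acting on functions that vanish off `U`, restricted to `U`.  The column of `y` is obtained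
from the indicator function of `{y}`. -/
noncomputable def killedGenerator (Γ : WeightedGraph V) (θ : V → ℝ) (U : Finset V) :
    Matrix U U ℝ :=
  Matrix.of fun x y => Γ.generator θ (Set.indicator {(y : V)} 1) x

open Classical in
/-- The heat kernel of the walk killed on leaving the finite set `U`.  The killed walk is a finite
state Markov chain, so its transition probabilities are the entries of the matrix exponential
`exp (t 𝓛_U)`; the kernel is their density with respect to `θ`, and is `0` unless both points
are in `U`. -/
noncomputable def killedHeatKernel (Γ : WeightedGraph V) (θ : V → ℝ) (U : Finset V)
    (t : ℝ) (x y : V) : ℝ :=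
  if h : x ∈ U ∧ y ∈ U then
    NormedSpace.exp (t • Γ.killedGenerator θ U) ⟨x, h.1⟩ ⟨y, h.2⟩ / θ y
  else 0

/-- The heat kernel `p_t(x,y) = ℙ^x(X_t = y) / θ_y` of the (minimal, possibly explosive)
continuous-time simple random walk, constructed by exhaustion: the killed heat kernels are
nonnegative, at most `1 / θ_y` and nondecreasing in the finite set `U`, and `p_t(x,y)` is their
limit, i.e. their supremum, as `U` increases to `V`. -/
noncomputable def heatKernel (Γ : WeightedGraph V) (θ : V → ℝ) (t : ℝ) (x y : V) : ℝ :=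
  ⨆ U : Finset V, Γ.killedHeatKernel θ U t x y

/-- The metric of `V` is adapted to the vertex weights `θ`. -/
def IsAdaptedMetric [MetricSpace V] (Γ : WeightedGraph V) (θ : V → ℝ) : Prop :=
  (∀ x, (1 / θ x) * ∑ y ∈ Γ.nbrs x, Γ.weight x y * dist x y ^ 2 ≤ 1) ∧
    ∀ x y, Γ.graph.Adj x y → dist x y ≤ 1

end WeightedGraph

/-- `(A, γ)`-regularity (on `(0, ∞)`) of a function `g : (0, ∞) → (0, ∞)`; the values of `g`
outside `(0, ∞)` play no role. -/
def IsRegularFun (A γ : ℝ) (g : ℝ → ℝ) : Prop :=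
  (∀ t, 0 < t → 0 < g t) ∧ MonotoneOn g (Set.Ioi 0) ∧
    ∀ t₁ t₂, 0 < t₁ → t₁ < t₂ → g (γ * t₁) / g t₁ ≤ A * (g (γ * t₂) / g t₂)

/-! Everything is proved for the walk killed outside a finite `U`, with constants independent of
`U`, and then passes to the supremum; explosion plays no role. On `U` the kernel is a matrix
exponential, symmetric with respect to `θ`.

Grigor'yan's argument: by the integral maximum principle (`energy_le`), the `L²` norm of the kernel
with weight `exp (2ψ)`, `ψ` being `l`-Lipschitz and `l ≤ 1`, grows at rate at most `2l²`. A
truncated distance as `ψ` bounds the mass outside radius `R` at time `t` by the mass outside a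
smaller radius `r` at an earlier time `s`, plus an exponentially small multiple of the diagonal
value at `2s` (`tailEnergy_step`). This is iterated with times `T γ⁻ᵏ` and radii decreasing to
`R/2`. The cap `l ≤ 1` stops the iteration when the time is comparable to `R`; there the point mass
at time `0` gives a bound `exp (-lR/4) / θ x`, and the growth condition on `f` absorbs `f`.

With `F = f s / f (s/γ)`, regularity gives diagonal values at most `(A F)ᵏ / f s` at time `s γ⁻ᵏ`.
If `A F` is small against `exp (κ R²/T)`, the errors sum to a Gaussian. Otherwise `f` grows so much
between `s/γ` and `s` that the trivial bound `1 / f s` is already Gaussian relative to `1 / f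
(s/γ)`. This dichotomy keeps the exponent and `α` independent of `A`.

Finally, each vertex is at distance at least `d(x₁,x₂)/2` from `x₁` or `x₂`, so the semigroup
property and Cauchy–Schwarz reduce the off-diagonal value to two tails. -/

namespace WeightedGraph

variable {V : Type*}

/-! ### The killed heat kernel: symmetry, semigroup property, heat equation -/

open Matrix in
/-- The exponential of a matrix which is self-adjoint with respect to a positive weight `d` is
again self-adjoint with respect to `d`. -/
theorem exp_detailedBalance {ι : Type*} [Fintype ι] [DecidableEq ι] (M : Matrix ι ι ℝ) (d : ι → ℝ)
    (hd : ∀ i, 0 < d i) (h : ∀ i j, d i * M i j = d j * M j i) (i j : ι) :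
    d i * NormedSpace.exp M i j = d j * NormedSpace.exp M j i := by
  have hU : IsUnit (diagonal d) := by
    rw [Matrix.isUnit_iff_isUnit_det, det_diagonal]
    exact (Finset.prod_pos fun i _ => hd i).ne'.isUnit
  have hdet : IsUnit (diagonal d).det := (Matrix.isUnit_iff_isUnit_det _).1 hU
  have hcomm : diagonal d * M = Mᵀ * diagonal d := by
    ext i j
    rw [diagonal_mul, mul_diagonal, transpose_apply, h, mul_comm]
  -- Detailed balance says that conjugation by `diagonal d` transposes `M`; the exponential commutes
  -- with both operations.
  have hT : diagonal d * M * (diagonal d)⁻¹ = Mᵀ := by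
    rw [hcomm, Matrix.mul_assoc, Matrix.mul_nonsing_inv _ hdet, Matrix.mul_one]
  have hexp := Matrix.exp_conj (diagonal d) M hU
  rw [hT, Matrix.exp_transpose] at hexp
  have hfin : (NormedSpace.exp M)ᵀ * diagonal d = diagonal d * NormedSpace.exp M := by
    rw [hexp, Matrix.mul_assoc, Matrix.nonsing_inv_mul _ hdet, Matrix.mul_one]
  have := congrFun (congrFun hfin i) j
  rw [diagonal_mul, mul_diagonal, transpose_apply] at this
  rw [← this, mul_comm]

section
attribute [local instance] Matrix.linftyOpNormedRing Matrix.linftyOpNormedAlgebra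

theorem hasDerivAt_exp_smul_apply {ι : Type*} [Fintype ι] [DecidableEq ι] (M : Matrix ι ι ℝ)
    (t : ℝ) (i j : ι) :
    HasDerivAt (fun t : ℝ => NormedSpace.exp (t • M) i j)
      (∑ k, M i k * NormedSpace.exp (t • M) k j) t := by
  have h := hasDerivAt_exp_smul_const' (𝕂 := ℝ) M t
  have h2 := ((Matrix.entryLinearMap ℝ ℝ i j : Matrix ι ι ℝ →ₗ[ℝ] ℝ).toContinuousLinearMap).hasFDerivAt.comp_hasDerivAt t h
  exact h2

end

variable (Γ : WeightedGraph V) (θ : V → ℝ)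

/-- The total weight of the edges at a vertex. -/
noncomputable def vertexWeight (x : V) : ℝ := ∑ y ∈ Γ.nbrs x, Γ.weight x y

theorem mem_nbrs {x y : V} : y ∈ Γ.nbrs x ↔ Γ.graph.Adj x y := by
  simp [nbrs]

theorem weight_eq_zero {x y : V} (h : y ∉ Γ.nbrs x) : Γ.weight x y = 0 := by
  rw [mem_nbrs, ← Γ.weight_pos_iff] at h
  exact le_antisymm (not_lt.1 h) (Γ.weight_nonneg x y)

theorem sum_weight_mul_le (U : Finset V) (x : V) (g : V → ℝ) (hg : ∀ y, 0 ≤ g y) :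
    ∑ y ∈ U, Γ.weight x y * g y ≤ ∑ y ∈ Γ.nbrs x, Γ.weight x y * g y := by
  classical
  have hnn : ∀ y, 0 ≤ Γ.weight x y * g y := fun y => mul_nonneg (Γ.weight_nonneg x y) (hg y)
  calc ∑ y ∈ U, Γ.weight x y * g y ≤ ∑ y ∈ U ∪ Γ.nbrs x, Γ.weight x y * g y :=
        Finset.sum_le_sum_of_subset_of_nonneg Finset.subset_union_left fun y _ _ => hnn y
    _ = ∑ y ∈ Γ.nbrs x, Γ.weight x y * g y := by
        symm
        refine Finset.sum_subset Finset.subset_union_right fun y _ hy => ?_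
        rw [Γ.weight_eq_zero hy, zero_mul]

theorem sum_weight_le_vertexWeight (U : Finset V) (x : V) :
    ∑ y ∈ U, Γ.weight x y ≤ Γ.vertexWeight x := by
  simpa [vertexWeight] using Γ.sum_weight_mul_le U x (fun _ => 1) fun _ => zero_le_one

open Classical in
theorem killedGenerator_apply (U : Finset V) (x y : U) :
    Γ.killedGenerator θ U x y =
      (1 / θ x) * (Γ.weight x y - if x = y then Γ.vertexWeight x else 0) := by
  have h1 : ∑ z ∈ Γ.nbrs x, Γ.weight x z * Set.indicator {(y : V)} (1 : V → ℝ) z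
      = Γ.weight x y := by
    by_cases hy : (y : V) ∈ Γ.nbrs x
    · rw [Finset.sum_eq_single_of_mem (y : V) hy]
      · simp
      · intro z _ hz
        simp [hz]
    · rw [Γ.weight_eq_zero hy]
      refine Finset.sum_eq_zero fun z hz => ?_
      have : z ≠ y := fun h => hy (h ▸ hz)
      simp [this]
  have h2 : ∑ z ∈ Γ.nbrs x, Γ.weight x z * Set.indicator {(y : V)} (1 : V → ℝ) x
      = if x = y then Γ.vertexWeight x else 0 := by
    rw [← Finset.sum_mul]
    by_cases h : x = y
    · simp [h, vertexWeight]
    · have : (x : V) ≠ y := fun h' => h (Subtype.ext h')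
      simp [h, this]
  simp only [killedGenerator, Matrix.of_apply, generator, mul_sub, Finset.sum_sub_distrib]
  rw [h1, h2]

theorem killedHeatKernel_of_notMem_left {U : Finset V} {x : V} (hx : x ∉ U) (t : ℝ) (y : V) :
    Γ.killedHeatKernel θ U t x y = 0 := by
  simp [killedHeatKernel, hx]

theorem killedHeatKernel_of_notMem_right {U : Finset V} {y : V} (hy : y ∉ U) (t : ℝ) (x : V) :
    Γ.killedHeatKernel θ U t x y = 0 := by
  simp [killedHeatKernel, hy]

open Classical in
theorem killedHeatKernel_coe (U : Finset V) (t : ℝ) (x y : U) :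
    Γ.killedHeatKernel θ U t x y = NormedSpace.exp (t • Γ.killedGenerator θ U) x y / θ y := by
  simp [killedHeatKernel]

variable {θ}

theorem killedHeatKernel_symm (hθ : ∀ x, 0 < θ x) (U : Finset V) (t : ℝ) (x y : V) :
    Γ.killedHeatKernel θ U t x y = Γ.killedHeatKernel θ U t y x := by
  classical
  by_cases hx : x ∈ U
  swap
  · rw [killedHeatKernel_of_notMem_left _ _ hx, killedHeatKernel_of_notMem_right _ _ hx]
  by_cases hy : y ∈ U
  swap
  · rw [killedHeatKernel_of_notMem_left _ _ hy, killedHeatKernel_of_notMem_right _ _ hy]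
  have h := exp_detailedBalance (t • Γ.killedGenerator θ U) (fun z : U => θ z) (fun z => hθ z)
    (fun i j => by
      have hi := (hθ i).ne'
      have hj := (hθ j).ne'
      simp only [Matrix.smul_apply, smul_eq_mul, killedGenerator_apply]
      rw [Γ.weight_symm i j]
      by_cases hij : i = j
      · subst hij; rfl
      · rw [if_neg hij, if_neg (Ne.symm hij)]
        field_simp) ⟨x, hx⟩ ⟨y, hy⟩
  have e1 := Γ.killedHeatKernel_coe θ U t ⟨x, hx⟩ ⟨y, hy⟩
  have e2 := Γ.killedHeatKernel_coe θ U t ⟨y, hy⟩ ⟨x, hx⟩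
  simp only at e1 e2 h
  rw [e1, e2, div_eq_div_iff (hθ y).ne' (hθ x).ne', mul_comm, h, mul_comm]

theorem killedHeatKernel_add (hθ : ∀ x, 0 < θ x) (U : Finset V) (s t : ℝ) (x y : V) :
    Γ.killedHeatKernel θ U (s + t) x y =
      ∑ z ∈ U, θ z * Γ.killedHeatKernel θ U s x z * Γ.killedHeatKernel θ U t z y := by
  classical
  by_cases hx : x ∈ U
  swap
  · simp [killedHeatKernel_of_notMem_left _ _ hx]
  by_cases hy : y ∈ U
  swap
  · simp [killedHeatKernel_of_notMem_right _ _ hy]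
  rw [← Finset.sum_coe_sort U]
  have e1 := Γ.killedHeatKernel_coe θ U (s + t) ⟨x, hx⟩ ⟨y, hy⟩
  simp only at e1
  rw [e1, add_smul, Matrix.exp_add_of_commute _ _
    (((Commute.refl (Γ.killedGenerator θ U)).smul_left s).smul_right t), Matrix.mul_apply,
    Finset.sum_div]
  refine Finset.sum_congr rfl fun z _ => ?_
  have e2 := Γ.killedHeatKernel_coe θ U s ⟨x, hx⟩ z
  have e3 := Γ.killedHeatKernel_coe θ U t z ⟨y, hy⟩
  simp only at e2 e3
  rw [e2, e3]
  have := (hθ z).ne'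
  field_simp

open Classical in
theorem killedHeatKernel_zero (U : Finset V) (x y : V) :
    Γ.killedHeatKernel θ U 0 x y = if x ∈ U ∧ x = y then 1 / θ y else 0 := by
  by_cases hx : x ∈ U
  swap
  · simp [killedHeatKernel_of_notMem_left _ _ hx, hx]
  by_cases hy : y ∈ U
  swap
  · have : x ≠ y := fun h => hy (h ▸ hx)
    simp [killedHeatKernel_of_notMem_right _ _ hy, this]
  have e1 := Γ.killedHeatKernel_coe θ U 0 ⟨x, hx⟩ ⟨y, hy⟩
  simp only at e1
  rw [e1, zero_smul, NormedSpace.exp_zero, Matrix.one_apply]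
  by_cases h : x = y <;> simp [h, hx, hy]

theorem hasDerivAt_killedHeatKernel {U : Finset V} {x : V} (hx : x ∈ U)
    (t : ℝ) (y : V) :
    HasDerivAt (fun t => Γ.killedHeatKernel θ U t x y)
      ((1 / θ x) * (∑ z ∈ U, Γ.weight x z * Γ.killedHeatKernel θ U t z y -
        Γ.vertexWeight x * Γ.killedHeatKernel θ U t x y)) t := by
  classical
  by_cases hy : y ∈ U
  swap
  · simpa [killedHeatKernel_of_notMem_right _ _ hy] using hasDerivAt_const t (0 : ℝ)
  have h := (hasDerivAt_exp_smul_apply (Γ.killedGenerator θ U) t ⟨x, hx⟩ ⟨y, hy⟩).div_const (θ y)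
  have e1 := fun t => Γ.killedHeatKernel_coe θ U t ⟨x, hx⟩ ⟨y, hy⟩
  have e2 := fun z => Γ.killedHeatKernel_coe θ U t z ⟨y, hy⟩
  simp only at e1 e2
  simp only [← e1] at h
  refine h.congr_deriv ?_
  rw [Finset.sum_div]
  simp only [mul_div_assoc, ← e2, killedGenerator_apply, mul_assoc]
  rw [← Finset.mul_sum]
  simp only [sub_mul, Finset.sum_sub_distrib]
  rw [Finset.sum_coe_sort U fun z => Γ.weight x z * Γ.killedHeatKernel θ U t z y]
  simp

end WeightedGraph

/-! ### The integral maximum principle -/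

namespace WeightedGraph

/-- Pointwise form of the integral maximum principle along an edge. -/
theorem weighted_mul_sub_le {a b p q s : ℝ} (hpq : |p - q| ≤ s) (hs : s ≤ 1) :
    Real.exp (2 * p) * a * (b - a) + Real.exp (2 * q) * b * (a - b) ≤
      s ^ 2 * (Real.exp (2 * p) * a ^ 2 + Real.exp (2 * q) * b ^ 2) := by
  set P := Real.exp p with hP
  set Q := Real.exp q with hQ
  have hP2 : Real.exp (2 * p) = P ^ 2 := by rw [hP, ← Real.exp_nat_mul]; norm_num
  have hQ2 : Real.exp (2 * q) = Q ^ 2 := by rw [hQ, ← Real.exp_nat_mul]; norm_num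
  have hPpos : 0 < P := Real.exp_pos _
  have hQpos : 0 < Q := Real.exp_pos _
  -- From `cosh u ≤ exp (u²/2)` and `exp v - 1 ≤ 2v` for `0 ≤ v ≤ 1`; this is where `s ≤ 1` is
  -- needed.
  have hcosh : Real.cosh (p - q) - 1 ≤ s ^ 2 := by
    have h1 := Real.cosh_le_exp_half_sq (p - q)
    have h2 : (p - q) ^ 2 ≤ s ^ 2 := sq_le_sq' (by linarith [neg_abs_le (p - q)])
      ((le_abs_self _).trans hpq)
    have hs0 : 0 ≤ s := (abs_nonneg _).trans hpq
    have h3 := Real.abs_exp_sub_one_le (x := (p - q) ^ 2 / 2) (by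
      rw [abs_of_nonneg (by positivity)]; nlinarith)
    rw [abs_of_nonneg (a := (p - q) ^ 2 / 2) (by positivity)] at h3
    linarith [le_abs_self (Real.exp ((p - q) ^ 2 / 2) - 1)]
  have hdiff : (P - Q) ^ 2 = 2 * (P * Q) * (Real.cosh (p - q) - 1) := by
    rw [Real.cosh_eq, neg_sub, Real.exp_sub, Real.exp_sub, ← hP, ← hQ]
    field_simp
    ring
  have hkey : a * b * (P - Q) ^ 2 ≤ s ^ 2 * (P ^ 2 * a ^ 2 + Q ^ 2 * b ^ 2) := by
    have h0 : 0 ≤ Real.cosh (p - q) - 1 := by linarith [Real.one_le_cosh (p - q)]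
    calc a * b * (P - Q) ^ 2 = 2 * (P * a) * (Q * b) * (Real.cosh (p - q) - 1) := by
          rw [hdiff]; ring
      _ ≤ (P ^ 2 * a ^ 2 + Q ^ 2 * b ^ 2) * (Real.cosh (p - q) - 1) := by
          refine mul_le_mul_of_nonneg_right ?_ h0
          nlinarith [sq_nonneg (P * a - Q * b)]
      _ ≤ (P ^ 2 * a ^ 2 + Q ^ 2 * b ^ 2) * s ^ 2 := by gcongr
      _ = _ := by ring
  rw [hP2, hQ2]
  -- The left side equals `a b (P - Q)² - (P a - Q b)²`.
  nlinarith [sq_nonneg (P * a - Q * b)]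

variable {V : Type*} (Γ : WeightedGraph V) {θ : V → ℝ}

/-- The weighted `L²` energy of the killed heat kernel started at `x`. -/
noncomputable def energy (θ : V → ℝ) (U : Finset V) (ψ : V → ℝ) (x : V) (t : ℝ) : ℝ :=
  ∑ y ∈ U, θ y * Real.exp (2 * ψ y) * Γ.killedHeatKernel θ U t y x ^ 2

theorem energy_zero (hθ : ∀ x, 0 < θ x) {U : Finset V} (ψ : V → ℝ) {x : V} (hx : x ∈ U) :
    Γ.energy θ U ψ x 0 = Real.exp (2 * ψ x) / θ x := by
  classical
  rw [energy, Finset.sum_eq_single_of_mem x hx]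
  · have := (hθ x).ne'
    rw [killedHeatKernel_zero, if_pos ⟨hx, rfl⟩]
    field_simp
  · intro y _ hy
    simp [killedHeatKernel_zero, hy]

theorem killedHeatKernel_two_mul (hθ : ∀ x, 0 < θ x) (U : Finset V) (x : V) (t : ℝ) :
    Γ.killedHeatKernel θ U (2 * t) x x =
      ∑ y ∈ U, θ y * Γ.killedHeatKernel θ U t y x ^ 2 := by
  rw [two_mul, Γ.killedHeatKernel_add hθ]
  refine Finset.sum_congr rfl fun y _ => ?_
  rw [Γ.killedHeatKernel_symm hθ U t x y]
  ring

theorem killedHeatKernel_self_nonneg (hθ : ∀ x, 0 < θ x) (U : Finset V) (x : V) (t : ℝ) :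
    0 ≤ Γ.killedHeatKernel θ U t x x := by
  rw [← mul_div_cancel₀ t two_ne_zero, Γ.killedHeatKernel_two_mul hθ]
  exact Finset.sum_nonneg fun y _ => mul_nonneg (hθ y).le (sq_nonneg _)

variable [MetricSpace V]

/-- The left side is half the time derivative of the energy. Edges leaving `U` contribute only
negatively and are dropped; the rest is symmetrised edge by edge, and the adapted metric turns the
sum of `π d²` at a vertex into `θ`. -/
theorem sum_weight_mul_sub_le (hθ : ∀ x, 0 < θ x) (hd : Γ.IsAdaptedMetric θ)
    (U : Finset V) (a ψ : V → ℝ) {l : ℝ} (hl0 : 0 ≤ l) (hl1 : l ≤ 1)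
    (hψ : ∀ y z, |ψ y - ψ z| ≤ l * dist y z) :
    ∑ y ∈ U, Real.exp (2 * ψ y) * a y *
        (∑ z ∈ U, Γ.weight y z * a z - Γ.vertexWeight y * a y) ≤
      l ^ 2 * ∑ y ∈ U, θ y * Real.exp (2 * ψ y) * a y ^ 2 := by
  set W := fun y => Real.exp (2 * ψ y) with hW
  set F := fun y z => Γ.weight y z * (W y * a y * (a z - a y)) with hF
  set H := fun y z => l ^ 2 * (Γ.weight y z * dist y z ^ 2) * (W y * a y ^ 2) with hH
  have hstep1 : ∑ y ∈ U, W y * a y * (∑ z ∈ U, Γ.weight y z * a z - Γ.vertexWeight y * a y)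
      ≤ ∑ y ∈ U, ∑ z ∈ U, F y z := by
    refine Finset.sum_le_sum fun y _ => ?_
    have h1 : ∑ z ∈ U, F y z = W y * a y * ∑ z ∈ U, Γ.weight y z * a z -
        W y * a y ^ 2 * ∑ z ∈ U, Γ.weight y z := by
      rw [Finset.mul_sum, Finset.mul_sum, ← Finset.sum_sub_distrib]
      exact Finset.sum_congr rfl fun z _ => by simp only [hF]; ring
    have h2 := mul_le_mul_of_nonneg_left (Γ.sum_weight_le_vertexWeight U y)
      (show 0 ≤ W y * a y ^ 2 from mul_nonneg (Real.exp_pos _).le (sq_nonneg _))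
    rw [h1]
    nlinarith
  have hedge : ∀ y z, F y z + F z y ≤ H y z + H z y := by
    intro y z
    by_cases hyz : Γ.graph.Adj y z
    · have h1 := weighted_mul_sub_le (a := a y) (b := a z) (hψ y z)
        (by nlinarith [hd.2 y z hyz, dist_nonneg (x := y) (y := z)])
      have h2 := mul_le_mul_of_nonneg_left h1 (Γ.weight_nonneg y z)
      simp only [hF, hH, hW, Γ.weight_symm z y, dist_comm z y]
      linarith
    · have h0 : Γ.weight y z = 0 := Γ.weight_eq_zero (by rwa [mem_nbrs])
      simp [hF, hH, Γ.weight_symm z y, h0]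
  have hsum : ∑ y ∈ U, ∑ z ∈ U, F y z ≤ ∑ y ∈ U, ∑ z ∈ U, H y z := by
    have h1 : ∑ y ∈ U, ∑ z ∈ U, (F y z + F z y) ≤ ∑ y ∈ U, ∑ z ∈ U, (H y z + H z y) :=
      Finset.sum_le_sum fun y _ => Finset.sum_le_sum fun z _ => hedge y z
    simp only [Finset.sum_add_distrib] at h1
    rw [Finset.sum_comm (f := fun y z => F z y), Finset.sum_comm (f := fun y z => H z y)] at h1
    linarith
  refine hstep1.trans (hsum.trans ?_)
  rw [Finset.mul_sum]
  refine Finset.sum_le_sum fun y _ => ?_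
  have h1 : ∑ z ∈ U, Γ.weight y z * dist y z ^ 2 ≤ θ y := by
    refine (Γ.sum_weight_mul_le U y (fun z => dist y z ^ 2) fun z => sq_nonneg _).trans ?_
    have := hd.1 y
    rwa [one_div, inv_mul_le_iff₀ (hθ y), mul_one] at this
  have h2 : ∑ z ∈ U, H y z =
      l ^ 2 * (W y * a y ^ 2) * ∑ z ∈ U, Γ.weight y z * dist y z ^ 2 := by
    rw [Finset.mul_sum]
    exact Finset.sum_congr rfl fun z _ => by simp only [hH]; ring
  rw [h2]
  have h3 : 0 ≤ l ^ 2 * (W y * a y ^ 2) := by positivity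
  nlinarith [mul_le_mul_of_nonneg_left h1 h3]

/-- The integral maximum principle: the growth of the energy with a Lipschitz weight. -/
theorem energy_le (hθ : ∀ x, 0 < θ x) (hd : Γ.IsAdaptedMetric θ)
    (U : Finset V) (ψ : V → ℝ) {l : ℝ} (hl0 : 0 ≤ l) (hl1 : l ≤ 1)
    (hψ : ∀ y z, |ψ y - ψ z| ≤ l * dist y z) (x : V) {s t : ℝ} (hst : s ≤ t) :
    Γ.energy θ U ψ x t ≤ Real.exp (2 * l ^ 2 * (t - s)) * Γ.energy θ U ψ x s := by
  set p := fun t y => Γ.killedHeatKernel θ U t y x with hp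
  set D := fun t => ∑ y ∈ U, Real.exp (2 * ψ y) * p t y *
        (∑ z ∈ U, Γ.weight y z * p t z - Γ.vertexWeight y * p t y) with hD
  have hderiv : ∀ t, HasDerivAt (Γ.energy θ U ψ x) (2 * D t) t := by
    intro t
    have h : HasDerivAt (fun t => ∑ y ∈ U, θ y * Real.exp (2 * ψ y) * p t y ^ 2)
        (∑ y ∈ U, θ y * Real.exp (2 * ψ y) * (2 * p t y ^ 1 *
          ((1 / θ y) * (∑ z ∈ U, Γ.weight y z * p t z - Γ.vertexWeight y * p t y)))) t :=
      HasDerivAt.fun_sum fun y hy =>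
        ((Γ.hasDerivAt_killedHeatKernel hy t x).pow 2).const_mul _
    refine h.congr_deriv ?_
    rw [hD, Finset.mul_sum]
    refine Finset.sum_congr rfl fun y _ => ?_
    have := (hθ y).ne'
    field_simp
  have hD_le : ∀ t, D t ≤ l ^ 2 * Γ.energy θ U ψ x t := fun t =>
    Γ.sum_weight_mul_sub_le hθ hd U (p t) ψ hl0 hl1 hψ
  have hanti : Antitone fun t => Real.exp (-(2 * l ^ 2) * t) * Γ.energy θ U ψ x t := by
    refine antitone_of_hasDerivAt_nonpos (f' := fun t =>
      Real.exp (-(2 * l ^ 2) * t) * (-(2 * l ^ 2) * 1) * Γ.energy θ U ψ x t +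
        Real.exp (-(2 * l ^ 2) * t) * (2 * D t))
      (fun t => (((hasDerivAt_id t).const_mul (-(2 * l ^ 2))).exp).mul (hderiv t)) fun t => ?_
    have h1 := hD_le t
    have h2 := Real.exp_pos (-(2 * l ^ 2) * t)
    have h3 := mul_le_mul_of_nonneg_left h1 h2.le
    simp only [Pi.zero_apply]
    linarith
  have h := hanti hst
  simp only at h
  have h2 := mul_le_mul_of_nonneg_left h (Real.exp_pos (2 * l ^ 2 * t)).le
  rw [← mul_assoc, ← mul_assoc, ← Real.exp_add, ← Real.exp_add] at h2
  have e1 : 2 * l ^ 2 * t + -(2 * l ^ 2) * t = 0 := by ring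
  have e2 : 2 * l ^ 2 * t + -(2 * l ^ 2) * s = 2 * l ^ 2 * (t - s) := by ring
  rwa [e1, e2, Real.exp_zero, one_mul] at h2

/-- The case `ψ = 0`, `l = 0` of `energy_le`. It makes the supremum defining the diagonal heat
kernel a genuine one. -/
theorem killedHeatKernel_self_le (hθ : ∀ x, 0 < θ x) (hd : Γ.IsAdaptedMetric θ)
    (U : Finset V) (x : V) {t : ℝ} (ht : 0 ≤ t) :
    Γ.killedHeatKernel θ U t x x ≤ 1 / θ x := by
  by_cases hx : x ∈ U
  · have h := Γ.energy_le hθ hd U 0 le_rfl zero_le_one (by simp) x (div_nonneg ht zero_le_two)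
    rw [Γ.energy_zero hθ _ hx] at h
    rw [← mul_div_cancel₀ t two_ne_zero, Γ.killedHeatKernel_two_mul hθ]
    simpa [energy] using h
  · rw [killedHeatKernel_of_notMem_left _ _ hx]
    exact (one_div_pos.2 (hθ x)).le

theorem killedHeatKernel_self_le_heatKernel (hθ : ∀ x, 0 < θ x) (hd : Γ.IsAdaptedMetric θ)
    (U : Finset V) (x : V) {t : ℝ} (ht : 0 ≤ t) :
    Γ.killedHeatKernel θ U t x x ≤ Γ.heatKernel θ t x x :=
  le_ciSup (f := fun U => Γ.killedHeatKernel θ U t x x)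
    ⟨1 / θ x, by rintro _ ⟨U, rfl⟩; exact Γ.killedHeatKernel_self_le hθ hd U x ht⟩ U

/-! ### Mass far from the starting point -/

open Classical in
/-- The `L²` mass of the killed heat kernel started at `x` outside the ball of radius `R`. -/
noncomputable def tailEnergy (θ : V → ℝ) (U : Finset V) (x : V) (R t : ℝ) : ℝ :=
  ∑ y ∈ U with R ≤ dist x y, θ y * Γ.killedHeatKernel θ U t y x ^ 2

theorem tailEnergy_nonneg (hθ : ∀ x, 0 < θ x) (U : Finset V) (x : V) (R t : ℝ) :
    0 ≤ Γ.tailEnergy θ U x R t :=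
  Finset.sum_nonneg fun y _ => mul_nonneg (hθ y).le (sq_nonneg _)

theorem tailEnergy_le_killedHeatKernel (hθ : ∀ x, 0 < θ x) (U : Finset V) (x : V) (R t : ℝ) :
    Γ.tailEnergy θ U x R t ≤ Γ.killedHeatKernel θ U (2 * t) x x := by
  rw [Γ.killedHeatKernel_two_mul hθ]
  exact Finset.sum_le_sum_of_subset_of_nonneg (Finset.filter_subset _ _)
    fun y _ _ => mul_nonneg (hθ y).le (sq_nonneg _)

theorem abs_truncated_dist_sub_le (x : V) (R : ℝ) {l : ℝ} (hl0 : 0 ≤ l) (y z : V) :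
    |l * (min (dist x y) R - R) - l * (min (dist x z) R - R)| ≤ l * dist y z := by
  rw [← mul_sub, abs_mul, abs_of_nonneg hl0]
  refine mul_le_mul_of_nonneg_left ?_ hl0
  rw [sub_sub_sub_cancel_right]
  refine (abs_min_sub_min_le_max _ _ _ _).trans ?_
  rw [sub_self, abs_zero, max_eq_left (abs_nonneg _), dist_comm x y, dist_comm x z]
  exact abs_dist_sub_le y z x

/-- The truncation makes the weight exactly `1` outside the ball of radius `R`. -/
theorem tailEnergy_le_energy (hθ : ∀ x, 0 < θ x) (U : Finset V) (x : V) (R t l : ℝ) :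
    Γ.tailEnergy θ U x R t ≤ Γ.energy θ U (fun y => l * (min (dist x y) R - R)) x t := by
  refine le_trans (Finset.sum_le_sum fun y hy => ?_)
    (Finset.sum_le_sum_of_subset_of_nonneg (Finset.filter_subset _ _) fun y _ _ => ?_)
  · beta_reduce
    rw [min_eq_right (Finset.mem_filter.1 hy).2]
    simp
  · have := hθ y
    positivity

theorem tailEnergy_le_exp (hθ : ∀ x, 0 < θ x) (hd : Γ.IsAdaptedMetric θ) {U : Finset V}
    {x : V} (hx : x ∈ U) {R t l : ℝ} (hR : 0 ≤ R) (ht : 0 ≤ t) (hl0 : 0 ≤ l) (hl1 : l ≤ 1) :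
    Γ.tailEnergy θ U x R t ≤ Real.exp (2 * l ^ 2 * t - 2 * l * R) / θ x := by
  have h := (Γ.tailEnergy_le_energy hθ U x R t l).trans
    (Γ.energy_le hθ hd U _ hl0 hl1 (abs_truncated_dist_sub_le x R hl0) x ht)
  rw [Γ.energy_zero hθ _ hx, mul_div_assoc', ← Real.exp_add, dist_self, min_eq_left hR] at h
  refine h.trans_eq ?_
  congr 2
  ring

/-- At the earlier time `s` the weight is at most `1` beyond radius `r` and at most `exp (-2l(R -
r))` within it, where the mass is bounded by the total. -/
theorem tailEnergy_step (hθ : ∀ x, 0 < θ x) (hd : Γ.IsAdaptedMetric θ) (U : Finset V)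
    (x : V) {R r s t l : ℝ} (hst : s ≤ t) (hl0 : 0 ≤ l) (hl1 : l ≤ 1) :
    Γ.tailEnergy θ U x R t ≤ Real.exp (2 * l ^ 2 * (t - s)) * (Γ.tailEnergy θ U x r s +
      Real.exp (-(2 * l * (R - r))) * Γ.killedHeatKernel θ U (2 * s) x x) := by
  classical
  refine ((Γ.tailEnergy_le_energy hθ U x R t l).trans
    (Γ.energy_le hθ hd U _ hl0 hl1 (abs_truncated_dist_sub_le x R hl0) x hst)).trans ?_
  refine mul_le_mul_of_nonneg_left ?_ (Real.exp_pos _).le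
  rw [Γ.killedHeatKernel_two_mul hθ, Finset.mul_sum, tailEnergy, energy, Finset.sum_filter,
    ← Finset.sum_add_distrib]
  refine Finset.sum_le_sum fun y _ => ?_
  have hm : 0 ≤ θ y * Γ.killedHeatKernel θ U s y x ^ 2 := mul_nonneg (hθ y).le (sq_nonneg _)
  have hrw : θ y * Real.exp (2 * (l * (min (dist x y) R - R))) * Γ.killedHeatKernel θ U s y x ^ 2
      = Real.exp (2 * (l * (min (dist x y) R - R))) *
        (θ y * Γ.killedHeatKernel θ U s y x ^ 2) := by ring
  rw [hrw]
  split_ifs with h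
  · have h1 : Real.exp (2 * (l * (min (dist x y) R - R))) ≤ 1 := by
      rw [Real.exp_le_one_iff]
      nlinarith [min_le_right (dist x y) R]
    nlinarith [Real.exp_pos (-(2 * l * (R - r))), mul_le_mul_of_nonneg_right h1 hm,
      mul_nonneg (Real.exp_pos (-(2 * l * (R - r)))).le hm]
  · rw [zero_add]
    refine mul_le_mul_of_nonneg_right (Real.exp_le_exp.2 ?_) hm
    nlinarith [min_le_left (dist x y) R, not_le.1 h]

/-- By the triangle inequality no vertex is within less than half of `dist x₁ x₂` of both points;
Cauchy–Schwarz is applied to each half of the semigroup sum. -/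
theorem killedHeatKernel_le_tailEnergy (hθ : ∀ x, 0 < θ x) (U : Finset V) (x₁ x₂ : V) (t : ℝ) :
    Γ.killedHeatKernel θ U (2 * t) x₁ x₂ ≤
      √(Γ.tailEnergy θ U x₁ (dist x₁ x₂ / 2) t) * √(Γ.killedHeatKernel θ U (2 * t) x₂ x₂) +
      √(Γ.killedHeatKernel θ U (2 * t) x₁ x₁) * √(Γ.tailEnergy θ U x₂ (dist x₁ x₂ / 2) t) := by
  classical
  set R := dist x₁ x₂ / 2
  set a := fun y => √(θ y) * Γ.killedHeatKernel θ U t y x₁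
  set b := fun y => √(θ y) * Γ.killedHeatKernel θ U t y x₂
  have ha : ∀ y, a y ^ 2 = θ y * Γ.killedHeatKernel θ U t y x₁ ^ 2 := fun y => by
    simp only [a, mul_pow, Real.sq_sqrt (hθ y).le]
  have hb : ∀ y, b y ^ 2 = θ y * Γ.killedHeatKernel θ U t y x₂ ^ 2 := fun y => by
    simp only [b, mul_pow, Real.sq_sqrt (hθ y).le]
  set A₁ := fun y => if R ≤ dist x₁ y then |a y| else 0
  set B₂ := fun y => if R ≤ dist x₂ y then |b y| else 0
  have h0 : Γ.killedHeatKernel θ U (2 * t) x₁ x₂ = ∑ y ∈ U, a y * b y := by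
    rw [two_mul, Γ.killedHeatKernel_add hθ]
    refine Finset.sum_congr rfl fun y _ => ?_
    rw [Γ.killedHeatKernel_symm hθ U t x₁ y]
    simp only [a, b]
    rw [mul_mul_mul_comm, Real.mul_self_sqrt (hθ y).le, mul_assoc]
  have h1 : ∑ y ∈ U, a y * b y ≤ ∑ y ∈ U, A₁ y * |b y| + ∑ y ∈ U, |a y| * B₂ y := by
    rw [← Finset.sum_add_distrib]
    refine Finset.sum_le_sum fun y _ => ?_
    have hab : a y * b y ≤ |a y| * |b y| := by rw [← abs_mul]; exact le_abs_self _
    have hn : 0 ≤ |a y| * |b y| := by positivity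
    by_cases h₁ : R ≤ dist x₁ y <;> by_cases h₂ : R ≤ dist x₂ y
    · simp only [A₁, B₂, h₁, h₂, if_true]; linarith
    · simp only [A₁, B₂, h₁, h₂, if_true, if_false]; linarith
    · simp only [A₁, B₂, h₁, h₂, if_true, if_false]; linarith
    · have := dist_triangle_right x₁ x₂ y
      exact absurd (show dist x₁ x₂ < dist x₁ x₂ by
        simp only [R] at h₁ h₂; linarith) (lt_irrefl _)
  have e1 : ∑ y ∈ U, A₁ y ^ 2 = Γ.tailEnergy θ U x₁ R t := by
    rw [tailEnergy, Finset.sum_filter]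
    refine Finset.sum_congr rfl fun y _ => ?_
    simp only [A₁]
    split_ifs <;> simp [ha]
  have e2 : ∑ y ∈ U, B₂ y ^ 2 = Γ.tailEnergy θ U x₂ R t := by
    rw [tailEnergy, Finset.sum_filter]
    refine Finset.sum_congr rfl fun y _ => ?_
    simp only [B₂]
    split_ifs <;> simp [hb]
  have e3 : ∑ y ∈ U, |a y| ^ 2 = Γ.killedHeatKernel θ U (2 * t) x₁ x₁ := by
    rw [Γ.killedHeatKernel_two_mul hθ]
    exact Finset.sum_congr rfl fun y _ => by rw [sq_abs, ha]
  have e4 : ∑ y ∈ U, |b y| ^ 2 = Γ.killedHeatKernel θ U (2 * t) x₂ x₂ := by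
    rw [Γ.killedHeatKernel_two_mul hθ]
    exact Finset.sum_congr rfl fun y _ => by rw [sq_abs, hb]
  rw [h0, ← e1, ← e2, ← e3, ← e4]
  exact h1.trans (add_le_add (Real.sum_mul_le_sqrt_mul_sqrt _ _ _)
    (Real.sum_mul_le_sqrt_mul_sqrt _ _ _))

end WeightedGraph


/-! ### Real-variable lemmas for the iteration -/

theorem IsRegularFun.le_pow_mul {A γ : ℝ} {f : ℝ → ℝ} (hf : IsRegularFun A γ f) (hA : 1 ≤ A)
    (hγ : 1 < γ) {s : ℝ} (hs : 0 < s) (k : ℕ) :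
    f s ≤ (A * (f s / f (s / γ))) ^ k * f (s / γ ^ k) := by
  have hγ0 : 0 < γ := zero_lt_one.trans hγ
  have hF : 0 < f s / f (s / γ) := div_pos (hf.1 _ hs) (hf.1 _ (by positivity))
  induction k with
  | zero => simp
  | succ k ih =>
    have hpos : 0 < f (s / γ ^ (k + 1)) := hf.1 _ (by positivity)
    have hratio : f (s / γ ^ k) / f (s / γ ^ (k + 1)) ≤ A * (f s / f (s / γ)) := by
      -- Regularity compares only distinct times; for `k = 0` the two ratios coincide and `1 ≤ A`
      -- suffices.
      rcases k.eq_zero_or_pos with rfl | hk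
      · simpa using le_mul_of_one_le_left hF.le hA
      · have h := hf.2.2 (s / γ ^ (k + 1)) (s / γ) (by positivity)
          (div_lt_div_of_pos_left hs hγ0 (by
            simpa using pow_lt_pow_right₀ hγ (show 1 < k + 1 by omega)))
        have e1 : γ * (s / γ ^ (k + 1)) = s / γ ^ k := by field_simp; ring
        have e2 : γ * (s / γ) = s := by field_simp
        rwa [e1, e2] at h
    rw [div_le_iff₀ hpos] at hratio
    calc f s ≤ (A * (f s / f (s / γ))) ^ k * f (s / γ ^ k) := ih
      _ ≤ (A * (f s / f (s / γ))) ^ k * (A * (f s / f (s / γ)) * f (s / γ ^ (k + 1))) := by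
          gcongr
      _ = _ := by ring

theorem le_of_forall_step_le {I P : ℕ → ℝ} {ρ a ε : ℝ} (hρ : 1 < ρ) (ha : 0 ≤ a) (hε : 0 ≤ ε)
    (hερ : 2 * ε * ρ ≤ ρ - 1) (hI : ∀ k, 0 ≤ I k) (hP : ∀ k, 0 ≤ P k) {n : ℕ}
    (h : ∀ k < n, I k ≤ Real.exp (2 * ε ^ 2 * a * ρ ^ k) *
      (I (k + 1) + Real.exp (-(2 * ε * a * ρ ^ k)) * P (k + 1))) :
    I 0 ≤ Real.exp (ε * a * ρ ^ n) * I n +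
      ∑ k ∈ Finset.range n, Real.exp (-(ε * a * ρ ^ k)) * P (k + 1) := by
  have hρ0 : 0 < ρ := zero_lt_one.trans hρ
  -- The extra `1 / ρ` leaves room for the next growth factor: `2ερ ≤ ρ - 1` keeps the accumulated
  -- growth below `exp (ε a ρᵐ)`, which costs half of the decay `exp (-2ε a ρᵐ)`.
  have key : ∀ m ≤ n, I 0 ≤ Real.exp (ε * a / ρ * ρ ^ m) * I m +
      ∑ k ∈ Finset.range m, Real.exp (-(ε * a * ρ ^ k)) * P (k + 1) := by
    intro m
    induction m with
    | zero =>
      intro _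
      simp only [pow_zero, mul_one, Finset.range_zero, Finset.sum_empty, add_zero]
      exact le_mul_of_one_le_left (hI 0) (Real.one_le_exp (by positivity))
    | succ m ih =>
      intro hm
      refine (ih (by omega)).trans ?_
      rw [Finset.sum_range_succ, add_comm _ (Real.exp _ * P (m + 1)), ← add_assoc]
      refine add_le_add_left ?_ _
      have e1 : ε * a / ρ * ρ ^ (m + 1) = ε * a * ρ ^ m := by field_simp; ring
      have hx : ε * a / ρ * ρ ^ m + 2 * ε ^ 2 * a * ρ ^ m ≤ ε * a * ρ ^ m := by
        have h1 : ε * a / ρ * ρ ^ m + 2 * ε ^ 2 * a * ρ ^ m =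
            ε * a * ρ ^ m * ((1 + 2 * ε * ρ) / ρ) := by field_simp
        rw [h1]
        refine mul_le_of_le_one_right (by positivity) ?_
        rw [div_le_one hρ0]
        linarith
      calc Real.exp (ε * a / ρ * ρ ^ m) * I m
          ≤ Real.exp (ε * a / ρ * ρ ^ m) * (Real.exp (2 * ε ^ 2 * a * ρ ^ m) *
            (I (m + 1) + Real.exp (-(2 * ε * a * ρ ^ m)) * P (m + 1))) := by
            gcongr
            exact h m (by omega)
        _ = Real.exp (ε * a / ρ * ρ ^ m + 2 * ε ^ 2 * a * ρ ^ m) *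
            (I (m + 1) + Real.exp (-(2 * ε * a * ρ ^ m)) * P (m + 1)) := by
            rw [Real.exp_add]; ring
        _ ≤ Real.exp (ε * a * ρ ^ m) *
            (I (m + 1) + Real.exp (-(2 * ε * a * ρ ^ m)) * P (m + 1)) := by
            have := hI (m + 1)
            have := hP (m + 1)
            gcongr
        _ = _ := by
            rw [e1, mul_add, ← mul_assoc, ← Real.exp_add]
            congr 3
            ring
  refine (key n le_rfl).trans (add_le_add_left (mul_le_mul_of_nonneg_right
    (Real.exp_le_exp.2 ?_) (hI n)) _)
  exact mul_le_mul_of_nonneg_right (div_le_self (by positivity) hρ.le) (by positivity)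

theorem sum_exp_neg_mul_pow_le {β E B κ c z : ℝ} (hβ : 1 ≤ β) (hz : 0 ≤ z) (hB : 0 ≤ B)
    (hBκ : 2 * B ≤ Real.exp (κ * z)) (hc : 0 ≤ c) (hcκ : c ≤ κ) (hκ₁ : 2 * κ ≤ E)
    (hκ₂ : 2 * κ ≤ E * (β - 1)) (n : ℕ) :
    ∑ k ∈ Finset.range n, Real.exp (-(E * z * β ^ k)) * B ^ (k + 1) ≤ Real.exp (-(c * z)) := by
  have hterm : ∀ k ∈ Finset.range n, Real.exp (-(E * z * β ^ k)) * B ^ (k + 1) ≤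
      (1 / 2 : ℝ) ^ k * (Real.exp (-(c * z)) / 2) := by
    intro k _
    have hB' : B ≤ Real.exp (κ * z) * (1 / 2) := by linarith
    have hpow : B ^ (k + 1) ≤ Real.exp ((k + 1) * (κ * z)) * ((1 / 2 : ℝ) ^ k * (1 / 2)) := by
      refine (pow_le_pow_left₀ hB hB' (k + 1)).trans_eq ?_
      rw [mul_pow, ← Real.exp_nat_mul, pow_succ (1 / 2 : ℝ), Nat.cast_add_one]
    -- Bernoulli: the geometric exponent dominates the linear one coming from `B ^ (k + 1)`, while
    -- the `2` in `2 * B` supplies the summable factor.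
    have hbern : 1 + (k : ℝ) * (β - 1) ≤ β ^ k := by
      have := one_add_mul_le_pow (a := β - 1) (by linarith) k
      rwa [add_sub_cancel] at this
    have hk0 : (0 : ℝ) ≤ k := Nat.cast_nonneg k
    have hE : 0 ≤ E := by linarith
    have h1 : (k + 1) * κ + c ≤ E * β ^ k := by
      have h2 := mul_le_mul_of_nonneg_left hbern hE
      have h3 := mul_le_mul_of_nonneg_left hκ₂ hk0
      have h4 : 0 ≤ (k : ℝ) * κ := mul_nonneg hk0 (hc.trans hcκ)
      linarith
    have h5 := mul_le_mul_of_nonneg_right h1 hz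
    calc Real.exp (-(E * z * β ^ k)) * B ^ (k + 1)
        ≤ Real.exp (-(E * z * β ^ k)) *
          (Real.exp ((k + 1) * (κ * z)) * ((1 / 2 : ℝ) ^ k * (1 / 2))) :=
          mul_le_mul_of_nonneg_left hpow (Real.exp_pos _).le
      _ = (1 / 2 : ℝ) ^ k * (Real.exp (-(E * z * β ^ k) + (k + 1) * (κ * z)) / 2) := by
          rw [Real.exp_add]; ring
      _ ≤ (1 / 2 : ℝ) ^ k * (Real.exp (-(c * z)) / 2) := by
          gcongr
          linarith
  refine (Finset.sum_le_sum hterm).trans ?_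
  rw [← Finset.sum_mul]
  have := mul_le_mul_of_nonneg_right (sum_geometric_two_le n)
    (show 0 ≤ Real.exp (-(c * z)) / 2 by positivity)
  linarith

/-! ### Iteration along geometric scales and the Gaussian tail bound -/

namespace WeightedGraph

variable {V : Type*} [MetricSpace V] (Γ : WeightedGraph V) {θ : V → ℝ}

/-- With time gap `τ` and radius gap `δ`, the slope is `l = ε δ / τ`, so growth and decay exponents
are `2ε²` and `2ε` times `δ² / τ`, which grows like `b ^ (2k)`. The condition `hk` keeps this slope
at most `1`. -/
theorem tailEnergy_geometric_step (hθ : ∀ x, 0 < θ x) (hd : Γ.IsAdaptedMetric θ) (U : Finset V)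
    (x : V) {b R T ε : ℝ} (hb : 1 < b) (hR : 0 < R) (hT : 0 < T) (hε0 : 0 < ε) (hε1 : ε ≤ 1)
    {k : ℕ} (hk : R * (b ^ k) ^ 4 ≤ T) :
    Γ.tailEnergy θ U x (R * (1 + 1 / b ^ k) / 2) (T / (b ^ 4) ^ k) ≤
      Real.exp (2 * ε ^ 2 * ((1 - 1 / b) ^ 2 / (4 * (1 - 1 / b ^ 4)) * (R ^ 2 / T)) *
          (b ^ 2) ^ k) *
        (Γ.tailEnergy θ U x (R * (1 + 1 / b ^ (k + 1)) / 2) (T / (b ^ 4) ^ (k + 1)) +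
          Real.exp (-(2 * ε * ((1 - 1 / b) ^ 2 / (4 * (1 - 1 / b ^ 4)) * (R ^ 2 / T)) *
            (b ^ 2) ^ k)) *
            Γ.killedHeatKernel θ U (2 * (T / (b ^ 4) ^ (k + 1))) x x) := by
  have hb0 : 0 < b := zero_lt_one.trans hb
  have hq : 0 < 1 - 1 / b := by rw [sub_pos, div_lt_one hb0]; exact hb
  have hqq : 1 - 1 / b ≤ 1 - 1 / b ^ 4 :=
    sub_le_sub_left (one_div_le_one_div_of_le hb0 (le_self_pow₀ hb.le (by norm_num))) _
  have hq4 : 0 < 1 - 1 / b ^ 4 := hq.trans_le hqq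
  set y := b ^ k with hy
  have hy1 : 1 ≤ y := one_le_pow₀ hb.le
  have hy0 : 0 < y := zero_lt_one.trans_le hy1
  have e4 : (b ^ 4) ^ k = y ^ 4 := by rw [hy, ← pow_mul, ← pow_mul, mul_comm]
  have e2 : (b ^ 2) ^ k = y ^ 2 := by rw [hy, ← pow_mul, ← pow_mul, mul_comm]
  rw [pow_succ b k, pow_succ (b ^ 4) k, ← hy, e4, e2]
  set w := 1 - 1 / b with hw
  set v := 1 - 1 / b ^ 4 with hv
  have hl1 : ε * R * w * y ^ 3 / (2 * T * v) ≤ 1 := by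
    rw [div_le_one (by positivity)]
    have h1 : y ^ 3 ≤ y ^ 4 := pow_le_pow_right₀ hy1 (by norm_num)
    calc ε * R * w * y ^ 3 ≤ 1 * R * v * y ^ 4 := by gcongr
      _ = R * y ^ 4 * v := by ring
      _ ≤ T * v := by gcongr
      _ ≤ 2 * T * v := by nlinarith [mul_pos hT hq4]
  have eτ : T / y ^ 4 - T / (y ^ 4 * b ^ 4) = T * v / y ^ 4 := by
    rw [hv]; field_simp
  have eδ : R * (1 + 1 / y) / 2 - R * (1 + 1 / (y * b)) / 2 = R * w / (2 * y) := by
    rw [hw]; field_simp; ring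
  have h := Γ.tailEnergy_step hθ hd U x (R := R * (1 + 1 / y) / 2)
    (r := R * (1 + 1 / (y * b)) / 2) (s := T / (y ^ 4 * b ^ 4)) (t := T / y ^ 4)
    (l := ε * R * w * y ^ 3 / (2 * T * v))
    (by
      have : 0 < T * v / y ^ 4 := by positivity
      linarith) (by positivity) hl1
  rw [eτ, eδ] at h
  have x1 : 2 * (ε * R * w * y ^ 3 / (2 * T * v)) ^ 2 * (T * v / y ^ 4) =
      2 * ε ^ 2 * (w ^ 2 / (4 * v) * (R ^ 2 / T)) * y ^ 2 := by field_simp; ring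
  have x2 : 2 * (ε * R * w * y ^ 3 / (2 * T * v)) * (R * w / (2 * y)) =
      2 * ε * (w ^ 2 / (4 * v) * (R ^ 2 / T)) * y ^ 2 := by field_simp; ring
  rwa [x1, x2] at h

theorem tailEnergy_le_sum (hθ : ∀ x, 0 < θ x) (hd : Γ.IsAdaptedMetric θ) {U : Finset V}
    {x : V} (hx : x ∈ U) {b R T ε l : ℝ} (hb : 1 < b) (hR : 0 < R) (hRT : R ≤ T) (hε0 : 0 < ε)
    (hεl : ε ≤ l) (hl : 4 * l * b ^ 4 ≤ 1) (hεb : 2 * ε * b ^ 2 ≤ b ^ 2 - 1) :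
    ∃ n : ℕ, Γ.tailEnergy θ U x R T ≤ Real.exp (-(l * R / 4)) / θ x +
      ∑ k ∈ Finset.range n,
        Real.exp (-(ε * ((1 - 1 / b) ^ 2 / (4 * (1 - 1 / b ^ 4)) * (R ^ 2 / T)) * (b ^ 2) ^ k)) *
          Γ.killedHeatKernel θ U (2 * (T / (b ^ 4) ^ (k + 1))) x x := by
  have hb0 : 0 < b := zero_lt_one.trans hb
  have hT : 0 < T := hR.trans_le hRT
  have hl0 : 0 < l := hε0.trans_le hεl
  have hb4 : 1 < b ^ 4 := one_lt_pow₀ hb (by norm_num)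
  have hl1 : l ≤ 1 := by nlinarith
  -- The last admissible scale: the terminal time lies between `R` and `b ^ 4 * R`.
  obtain ⟨n, hn, hn'⟩ := exists_nat_pow_near ((one_le_div hR).2 hRT) hb4
  have hn2 : R * (b ^ 4) ^ n ≤ T := by rw [le_div_iff₀ hR] at hn; linarith
  have hn3 : T ≤ b ^ 4 * R * (b ^ 4) ^ n := by
    rw [div_lt_iff₀ hR, pow_succ] at hn'; linarith
  set a := (1 - 1 / b) ^ 2 / (4 * (1 - 1 / b ^ 4)) * (R ^ 2 / T) with ha
  have hq : 0 < 1 - 1 / b := by rw [sub_pos, div_lt_one hb0]; exact hb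
  have hqq : 1 - 1 / b ≤ 1 - 1 / b ^ 4 :=
    sub_le_sub_left (one_div_le_one_div_of_le hb0 (le_self_pow₀ hb.le (by norm_num))) _
  have hq4 : 0 < 1 - 1 / b ^ 4 := hq.trans_le hqq
  have ha0 : 0 ≤ a := by positivity
  have ha1 : a ≤ 1 / 4 * (R ^ 2 / T) := by
    refine mul_le_mul_of_nonneg_right ?_ (by positivity)
    rw [div_le_iff₀ (by positivity)]
    have : 1 - 1 / b ≤ 1 := by
      have := one_div_pos.2 hb0
      linarith
    nlinarith
  have hiter := le_of_forall_step_le (I := fun k =>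
      Γ.tailEnergy θ U x (R * (1 + 1 / b ^ k) / 2) (T / (b ^ 4) ^ k))
    (P := fun k => Γ.killedHeatKernel θ U (2 * (T / (b ^ 4) ^ k)) x x)
    (ρ := b ^ 2) (a := a) (ε := ε) (n := n) (one_lt_pow₀ hb (by norm_num)) ha0 hε0.le hεb
    (fun k => Γ.tailEnergy_nonneg hθ U x _ _)
    (fun k => Γ.killedHeatKernel_self_nonneg hθ U x _)
    (fun k hk => Γ.tailEnergy_geometric_step hθ hd U x hb hR hT hε0 (hεl.trans hl1) (by
      rw [← pow_mul, mul_comm k, pow_mul]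
      exact le_trans (by gcongr; exact hb4.le) hn2))
  refine ⟨n, ?_⟩
  simp only [pow_zero, div_one] at hiter
  rw [one_add_one_eq_two, mul_div_cancel_right₀ R two_ne_zero] at hiter
  refine hiter.trans (add_le_add_left ?_ _)
  have hbn : 0 < 1 / b ^ n := by positivity
  have hinit := Γ.tailEnergy_le_exp hθ hd hx (R := R * (1 + 1 / b ^ n) / 2)
    (t := T / (b ^ 4) ^ n) (l := l) (by positivity) (by positivity) hl0.le hl1
  refine (mul_le_mul_of_nonneg_left hinit (Real.exp_pos _).le).trans ?_
  rw [mul_div_assoc', ← Real.exp_add]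
  refine div_le_div_of_nonneg_right (Real.exp_le_exp.2 ?_) (hθ x).le
  have h1 : a * (b ^ 2) ^ n ≤ R / 4 := by
    have h2 : (b ^ 2) ^ n ≤ (b ^ 4) ^ n :=
      pow_le_pow_left₀ (by positivity) (pow_le_pow_right₀ hb.le (by norm_num)) _
    calc a * (b ^ 2) ^ n ≤ 1 / 4 * (R ^ 2 / T) * (b ^ 4) ^ n := by gcongr
      _ = R / 4 * (R * (b ^ 4) ^ n) / T := by ring
      _ ≤ R / 4 * T / T := by gcongr
      _ = R / 4 := by field_simp
  have h3 : ε * a * (b ^ 2) ^ n ≤ l * (R / 4) := by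
    rw [mul_assoc]
    exact mul_le_mul hεl h1 (by positivity) hl0.le
  have h4 : T / (b ^ 4) ^ n ≤ b ^ 4 * R := by
    rw [div_le_iff₀ (by positivity)]; exact hn3
  have h5 : 2 * l ^ 2 * (T / (b ^ 4) ^ n) ≤ l * R / 2 := by
    calc 2 * l ^ 2 * (T / (b ^ 4) ^ n) ≤ 2 * l ^ 2 * (b ^ 4 * R) := by gcongr
      _ = (4 * l * b ^ 4) * (l * R / 2) := by ring
      _ ≤ 1 * (l * R / 2) := by gcongr
      _ = _ := one_mul _
  have h6 : l * R ≤ 2 * l * (R * (1 + 1 / b ^ n) / 2) := by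
    nlinarith [mul_pos (mul_pos hl0 hR) hbn]
  -- The exponents are at most `lR/4` (accumulated growth), `lR/2` (terminal time) and `-lR`
  -- (terminal radius at least `R/2`).
  linarith

/-- Gaussian decay of the off-diagonal `L²` mass of the killed heat kernel. -/
theorem tailEnergy_le_gaussian (hθ : ∀ x, 0 < θ x) (hd : Γ.IsAdaptedMetric θ) {U : Finset V}
    {x : V} (hx : x ∈ U) {b R T ε l κ c α A m : ℝ} {f : ℝ → ℝ} (hb : 1 < b) (hR : 0 ≤ R)
    (hT : 0 < T) (hRT : R ≤ T) (hε0 : 0 < ε)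
    (hεl : ε ≤ l) (hl : 4 * l * b ^ 4 ≤ 1) (hεb : 2 * ε * b ^ 2 ≤ b ^ 2 - 1)
    (hκ₁ : 2 * κ ≤ ε * ((1 - 1 / b) ^ 2 / (4 * (1 - 1 / b ^ 4))))
    (hκ₂ : 2 * κ ≤ ε * ((1 - 1 / b) ^ 2 / (4 * (1 - 1 / b ^ 4))) * (b ^ 2 - 1))
    (hc : 0 < c) (hcκ : c ≤ κ) (hcl : c ≤ l / 8) (hα : 0 < α) (hαl : 128 * α ≤ l ^ 2)
    (hA : 1 ≤ A) (hm : 0 < m) (hmθ : m ≤ θ x)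
    (hf : IsRegularFun A (b ^ 4) f) (hfA : ∀ t, 0 < t → f t / Real.exp √t ≤ A)
    (hp : ∀ t, 0 < t → Γ.killedHeatKernel θ U t x x ≤ 1 / f t) :
    Γ.tailEnergy θ U x R T ≤
      (Real.exp c + 2 * A + 1 + A / m) / f (α * (2 * T)) * Real.exp (-(c * (R ^ 2 / T))) := by
  have hb0 : 0 < b := zero_lt_one.trans hb
  have hb4 : 1 < b ^ 4 := one_lt_pow₀ hb (by norm_num)
  have hl0 : 0 < l := hε0.trans_le hεl
  have hl1 : l ≤ 1 := by nlinarith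
  have hαb : α ≤ 1 / b ^ 4 := by
    rw [le_div_iff₀ (by positivity)]; nlinarith
  have hα1 : α ≤ 1 := hαb.trans (by rw [div_le_one (by positivity)]; exact hb4.le)
  have hA0 : 0 < A := zero_lt_one.trans_le hA
  set s := 2 * T with hs
  have hs0 : 0 < s := by positivity
  have hfα : 0 < f (α * s) := hf.1 _ (by positivity)
  have hfs : 0 < f s := hf.1 _ hs0
  have hmono : f (α * s) ≤ f s := hf.2.1 (show 0 < α * s by positivity) hs0
    (mul_le_of_le_one_left hs0.le hα1)
  have hmonob : f (α * s) ≤ f (s / b ^ 4) :=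
    hf.2.1 (show 0 < α * s by positivity) (show 0 < s / b ^ 4 by positivity) (by
      rw [div_eq_mul_one_div, mul_comm]
      gcongr)
  have hfb : 0 < f (s / b ^ 4) := hf.1 _ (by positivity)
  have htriv : Γ.tailEnergy θ U x R T ≤ 1 / f s :=
    (Γ.tailEnergy_le_killedHeatKernel hθ U x R T).trans (hp s hs0)
  set z := R ^ 2 / T with hz
  have hz0 : 0 ≤ z := by positivity
  have hec := Real.exp_pos c
  have hE := Real.exp_pos (-(c * z))
  have hAm : 0 < A / m := by positivity
  have conclude : ∀ {D : ℝ}, D ≤ Real.exp c + 2 * A + 1 + A / m →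
      Γ.tailEnergy θ U x R T ≤ D / f (α * s) * Real.exp (-(c * z)) →
      Γ.tailEnergy θ U x R T ≤
        (Real.exp c + 2 * A + 1 + A / m) / f (α * s) * Real.exp (-(c * z)) := by
    intro D hD h
    exact h.trans (by gcongr)
  rcases lt_or_ge (R ^ 2) T with hsmall | hlarge
  -- Here `R² / T ≤ 1`, so the Gaussian factor costs at most `exp c`.
  · refine conclude (D := Real.exp c) (by linarith) (htriv.trans ?_)
    rw [div_mul_eq_mul_div, ← Real.exp_add]
    refine div_le_div₀ (Real.exp_pos _).le (Real.one_le_exp ?_) hfα hmono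
    have : z ≤ 1 := by rw [hz, div_le_one hT]; exact hsmall.le
    nlinarith
  have hR0 : 0 < R := by
    rcases hR.eq_or_lt with h | h
    · rw [← h] at hlarge; norm_num at hlarge; linarith
    · exact h
  set F := f s / f (s / b ^ 4) with hF
  have hF0 : 0 < F := div_pos hfs hfb
  -- The dichotomy on the growth of `f` between `s / b ^ 4` and `s`.
  rcases lt_or_ge (Real.exp (κ * z)) (2 * (A * F)) with hbig | hcase
  · refine conclude (D := 2 * A) (by linarith) (htriv.trans ?_)
    have h1 : 1 ≤ 2 * A * F * Real.exp (-(κ * z)) := by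
      rw [Real.exp_neg, ← div_eq_mul_inv, one_le_div (Real.exp_pos _)]
      linarith
    have hfF : f s = F * f (s / b ^ 4) := by rw [hF]; field_simp
    calc 1 / f s ≤ 2 * A * F * Real.exp (-(κ * z)) / f s := by gcongr
      _ = 2 * A / f (s / b ^ 4) * Real.exp (-(κ * z)) := by rw [hfF]; field_simp
      _ ≤ 2 * A / f (α * s) * Real.exp (-(c * z)) := by gcongr
  refine conclude (D := 1 + A / m) (by linarith) ?_
  obtain ⟨n, hn⟩ := Γ.tailEnergy_le_sum hθ hd hx hb hR0 hRT hε0 hεl hl hεb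
  refine hn.trans ?_
  set a₀ := (1 - 1 / b) ^ 2 / (4 * (1 - 1 / b ^ 4)) with ha₀
  have hfirst : Real.exp (-(l * R / 4)) / θ x ≤ A / m / f (α * s) * Real.exp (-(c * z)) := by
    -- Uses `T ≤ R²` and `128 α ≤ l²`. Half of the decay `exp (-lR/4)` pays for `f (α * s)`, the
    -- other half for the Gaussian, since `R² / T ≤ R`.
    have hsq : √(α * s) ≤ l * R / 8 := by
      refine Real.sqrt_le_iff.2 ⟨by positivity, ?_⟩
      calc α * s = 128 * α * T / 64 := by rw [hs]; ring
        _ ≤ l ^ 2 * R ^ 2 / 64 := by gcongr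
        _ = _ := by ring
    have h1 : f (α * s) ≤ A * Real.exp (l * R / 8) := by
      have := hfA (α * s) (by positivity)
      rw [div_le_iff₀ (Real.exp_pos _)] at this
      exact this.trans (by gcongr)
    have h2 : c * z ≤ l * R / 8 := by
      have : z ≤ R := by
        rw [hz, div_le_iff₀ hT]
        nlinarith
      calc c * z ≤ l / 8 * R := by gcongr
        _ = _ := by ring
    calc Real.exp (-(l * R / 4)) / θ x ≤ Real.exp (-(l * R / 4)) / m := by gcongr
      _ ≤ Real.exp (-(l * R / 4)) / m * (A * Real.exp (l * R / 8) / f (α * s)) :=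
          le_mul_of_one_le_right (by positivity) ((one_le_div hfα).2 h1)
      _ = A / m / f (α * s) * (Real.exp (-(l * R / 4)) * Real.exp (l * R / 8)) := by
          field_simp
      _ ≤ A / m / f (α * s) * Real.exp (-(c * z)) := by
          rw [← Real.exp_add]
          gcongr
          linarith
  have hterm : ∀ k ∈ Finset.range n,
      Real.exp (-(ε * (a₀ * z) * (b ^ 2) ^ k)) *
        Γ.killedHeatKernel θ U (2 * (T / (b ^ 4) ^ (k + 1))) x x ≤
      Real.exp (-(ε * a₀ * z * (b ^ 2) ^ k)) * (A * F) ^ (k + 1) / f s := by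
    intro k _
    have h1 : Γ.killedHeatKernel θ U (2 * (T / (b ^ 4) ^ (k + 1))) x x ≤
        (A * F) ^ (k + 1) / f s := by
      have e : 2 * (T / (b ^ 4) ^ (k + 1)) = s / (b ^ 4) ^ (k + 1) := by rw [hs]; ring
      rw [e]
      have hpos : 0 < s / (b ^ 4) ^ (k + 1) := by positivity
      refine (hp _ hpos).trans ?_
      rw [div_le_div_iff₀ (hf.1 _ hpos) hfs, one_mul]
      exact hf.le_pow_mul hA hb4 hs0 (k + 1)
    calc _ ≤ Real.exp (-(ε * (a₀ * z) * (b ^ 2) ^ k)) * ((A * F) ^ (k + 1) / f s) := by gcongr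
      _ = _ := by ring_nf
  have hsum := Finset.sum_le_sum hterm
  rw [← Finset.sum_div] at hsum
  have hgeom := sum_exp_neg_mul_pow_le (β := b ^ 2) (E := ε * a₀) (B := A * F)
    (one_le_pow₀ hb.le) hz0 (by positivity) hcase hc.le hcκ hκ₁ hκ₂ n
  have hsum2 : (∑ k ∈ Finset.range n, Real.exp (-(ε * a₀ * z * (b ^ 2) ^ k)) *
      (A * F) ^ (k + 1)) / f s ≤ 1 / f (α * s) * Real.exp (-(c * z)) := by
    rw [one_div_mul_eq_div]
    exact div_le_div₀ hE.le hgeom hfα hmono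
  calc _ ≤ A / m / f (α * s) * Real.exp (-(c * z)) + 1 / f (α * s) * Real.exp (-(c * z)) :=
        add_le_add hfirst (hsum.trans hsum2)
    _ = _ := by ring

end WeightedGraph


/-! ### Choice of constants and conclusion -/

/-- The constants entering the Gaussian estimate, for a given ratio. -/
theorem exists_gaussian_constants {b : ℝ} (hb : 1 < b) :
    ∃ ε l κ c α : ℝ, 0 < ε ∧ ε ≤ l ∧ 4 * l * b ^ 4 ≤ 1 ∧ 2 * ε * b ^ 2 ≤ b ^ 2 - 1 ∧
      2 * κ ≤ ε * ((1 - 1 / b) ^ 2 / (4 * (1 - 1 / b ^ 4))) ∧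
      2 * κ ≤ ε * ((1 - 1 / b) ^ 2 / (4 * (1 - 1 / b ^ 4))) * (b ^ 2 - 1) ∧
      0 < c ∧ c ≤ κ ∧ c ≤ l / 8 ∧ 0 < α ∧ α ≤ 1 ∧ 128 * α ≤ l ^ 2 := by
  have hb0 : 0 < b := zero_lt_one.trans hb
  have hb4 : 1 < b ^ 4 := one_lt_pow₀ hb (by norm_num)
  have hb2 : 0 < b ^ 2 - 1 := sub_pos.2 (one_lt_pow₀ hb (by norm_num))
  have hq : 0 < 1 - 1 / b := by rw [sub_pos, div_lt_one hb0]; exact hb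
  have hq4 : 0 < 1 - 1 / b ^ 4 := by rw [sub_pos, div_lt_one (by positivity)]; exact hb4
  set a := (1 - 1 / b) ^ 2 / (4 * (1 - 1 / b ^ 4))
  have ha : 0 < a := by positivity
  set l := 1 / (4 * b ^ 4) with hl
  have hl0 : 0 < l := by positivity
  have hl1 : l ≤ 1 := by rw [hl, div_le_one (by positivity)]; linarith
  set ε := min ((b ^ 2 - 1) / (2 * b ^ 2)) l
  have hε : 0 < ε := by positivity
  set κ := min (ε * a) (ε * a * (b ^ 2 - 1)) / 2 with hκ
  have hκ0 : 0 < κ := by positivity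
  refine ⟨ε, l, κ, min κ (l / 8), l ^ 2 / 128, hε, min_le_right _ _, ?_, ?_, ?_, ?_,
    by positivity, min_le_left _ _, min_le_right _ _, by positivity, by nlinarith, by linarith⟩
  · rw [hl]
    exact (by field_simp : 4 * (1 / (4 * b ^ 4)) * b ^ 4 = 1).le
  · have h : ε ≤ (b ^ 2 - 1) / (2 * b ^ 2) := min_le_left _ _
    rw [le_div_iff₀ (by positivity)] at h
    linarith
  · linarith [min_le_left (ε * a) (ε * a * (b ^ 2 - 1))]
  · linarith [min_le_right (ε * a) (ε * a * (b ^ 2 - 1))]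

theorem theorem1p1 :
    ∀ γ : ℝ, 1 < γ → ∃ C₂ α : ℝ, 0 < C₂ ∧ 0 < α ∧
      ∀ A Cθ : ℝ, 1 ≤ A → 0 < Cθ → ∃ C₁ : ℝ, 0 < C₁ ∧
        ∀ (V : Type*) [Countable V] [Infinite V] [MetricSpace V]
          (Γ : WeightedGraph V) (θ : V → ℝ),
          (∀ x, Cθ ≤ θ x) → Γ.IsAdaptedMetric θ →
          ∀ (f₁ f₂ : ℝ → ℝ), IsRegularFun A γ f₁ → IsRegularFun A γ f₂ →
            (∀ t, 0 < t → f₁ t / Real.exp √t ≤ A) →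
            (∀ t, 0 < t → f₂ t / Real.exp √t ≤ A) →
            ∀ x₁ x₂ : V,
              (∀ t, 0 < t → Γ.heatKernel θ t x₁ x₁ ≤ 1 / f₁ t) →
              (∀ t, 0 < t → Γ.heatKernel θ t x₂ x₂ ≤ 1 / f₂ t) →
              ∀ t, max 1 (dist x₁ x₂) ≤ t →
                Γ.heatKernel θ t x₁ x₂ ≤
                  C₁ / √(f₁ (α * t) * f₂ (α * t)) * Real.exp (-(C₂ * dist x₁ x₂ ^ 2 / t)) := by
  intro γ hγ
  obtain ⟨b, hb, rfl⟩ : ∃ b : ℝ, 1 < b ∧ b ^ 4 = γ := by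
    refine ⟨√√γ, ?_, ?_⟩
    · rw [Real.lt_sqrt zero_le_one, Real.lt_sqrt (by norm_num)]
      simpa using hγ
    · rw [show (4 : ℕ) = 2 * 2 from rfl, pow_mul, Real.sq_sqrt (Real.sqrt_nonneg _),
        Real.sq_sqrt (by linarith)]
  obtain ⟨ε, l, κ, c, α, hε, hεl, hl, hεb, hκ₁, hκ₂, hc, hcκ, hcl, hα, hα1, hαl⟩ :=
    exists_gaussian_constants hb
  -- Tails are taken at radius `d/2` and time `t/2`, giving `c d² / (2t)`; the square root from
  -- Cauchy–Schwarz halves this again.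
  refine ⟨c / 4, α, by positivity, hα, fun A m hA hm => ?_⟩
  have hA0 : 0 < A := zero_lt_one.trans_le hA
  set K := Real.exp c + 2 * A + 1 + A / m with hK
  have hK0 : 0 < K := by positivity
  refine ⟨2 * √K, by positivity, ?_⟩
  intro V _ _ _ Γ θ hmθ hd f₁ f₂ hf₁ hf₂ hfA₁ hfA₂ x₁ x₂ hp₁ hp₂ t ht
  have ht0 : 0 < t := zero_lt_one.trans_le ((le_max_left _ _).trans ht)
  have hdt : dist x₁ x₂ ≤ t := (le_max_right _ _).trans ht
  have hθ : ∀ x, 0 < θ x := fun x => hm.trans_le (hmθ x)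
  have hrhs : 0 ≤ 2 * √K / √(f₁ (α * t) * f₂ (α * t)) *
      Real.exp (-(c / 4 * dist x₁ x₂ ^ 2 / t)) := by positivity
  refine ciSup_le fun U => ?_
  by_cases hx₁ : x₁ ∈ U
  swap
  · rw [Γ.killedHeatKernel_of_notMem_left θ hx₁]; exact hrhs
  by_cases hx₂ : x₂ ∈ U
  swap
  · rw [Γ.killedHeatKernel_of_notMem_right θ hx₂]; exact hrhs
  have hpU₁ : ∀ t, 0 < t → Γ.killedHeatKernel θ U t x₁ x₁ ≤ 1 / f₁ t := fun t ht =>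
    (Γ.killedHeatKernel_self_le_heatKernel hθ hd U x₁ ht.le).trans (hp₁ t ht)
  have hpU₂ : ∀ t, 0 < t → Γ.killedHeatKernel θ U t x₂ x₂ ≤ 1 / f₂ t := fun t ht =>
    (Γ.killedHeatKernel_self_le_heatKernel hθ hd U x₂ ht.le).trans (hp₂ t ht)
  set e := Real.exp (-(c / 4 * dist x₁ x₂ ^ 2 / t)) with he
  have he2 : Real.exp (-(c * ((dist x₁ x₂ / 2) ^ 2 / (t / 2)))) = e ^ 2 := by
    rw [he, ← Real.exp_nat_mul]
    congr 1
    push_cast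
    field_simp
    ring
  have h2t : 2 * (t / 2) = t := mul_div_cancel₀ t two_ne_zero
  have hαt : α * t ≤ t := mul_le_of_le_one_left ht0.le hα1
  have tail : ∀ {x : V} {f : ℝ → ℝ}, x ∈ U → IsRegularFun A (b ^ 4) f →
      (∀ t, 0 < t → f t / Real.exp √t ≤ A) →
      (∀ t, 0 < t → Γ.killedHeatKernel θ U t x x ≤ 1 / f t) →
      √(Γ.tailEnergy θ U x (dist x₁ x₂ / 2) (t / 2)) ≤ √K / √(f (α * t)) * e := by
    intro x f hx hf hfA hp
    have h := Γ.tailEnergy_le_gaussian hθ hd hx hb (R := dist x₁ x₂ / 2) (T := t / 2)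
      (by positivity) (by positivity) (by linarith) hε hεl hl hεb hκ₁ hκ₂ hc hcκ hcl hα hαl hA
      hm (hmθ x) hf hfA hp
    rw [he2, h2t] at h
    refine (Real.sqrt_le_sqrt h).trans_eq ?_
    rw [Real.sqrt_mul' _ (sq_nonneg e), Real.sqrt_sq (Real.exp_pos _).le,
      Real.sqrt_div hK0.le]
  have diag : ∀ {x : V} {f : ℝ → ℝ}, IsRegularFun A (b ^ 4) f →
      (∀ t, 0 < t → Γ.killedHeatKernel θ U t x x ≤ 1 / f t) →
      √(Γ.killedHeatKernel θ U t x x) ≤ 1 / √(f (α * t)) := by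
    intro x f hf hp
    have hαt0 : 0 < α * t := by positivity
    rw [← Real.sqrt_one, ← Real.sqrt_div zero_le_one]
    exact Real.sqrt_le_sqrt ((hp t ht0).trans
      (one_div_le_one_div_of_le (hf.1 _ hαt0) (hf.2.1 hαt0 ht0 hαt)))
  have hαt0 : 0 < α * t := by positivity
  have h := Γ.killedHeatKernel_le_tailEnergy hθ U x₁ x₂ (t / 2)
  rw [h2t] at h
  refine h.trans ((add_le_add
    (mul_le_mul (tail hx₁ hf₁ hfA₁ hpU₁) (diag hf₂ hpU₂) (Real.sqrt_nonneg _) (by positivity))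
    (mul_le_mul (diag hf₁ hpU₁) (tail hx₂ hf₂ hfA₂ hpU₂) (Real.sqrt_nonneg _)
      (by positivity))).trans_eq ?_)
  rw [Real.sqrt_mul (hf₁.1 _ hαt0).le]
  ring
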